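/- Let $p$ be a positive integer, let $S$ be a fixed $p\times p$ symmetric positive semidefinite real matrix, and let $\lambda>0$ and $\alpha\in[0,1]$. Put $$g_\alpha(\theta)=\sum_{i,j}\Big(\alpha\lambda|\theta_{ij}|+\tfrac{1-\alpha}{2}\lambda\theta_{ij}^2\Big),\qquad \phi_\alpha(\theta)=-\log\det\theta+\mathrm{Tr}(\theta S)+g_\alpha(\theta),$$ let $\mathcal M$ be the set of symmetric $p\times p$ matrices, $\mathcal M_+$ the set of positive definite ones, and $\|A\|_F=\sqrt{\mathrm{Tr}(A'A)}$. For $0<\ell\le\psi\le\infty$ let $\mathcal M_+(\ell,\psi)$ be the set of $\theta\in\mathcal M_+$ with $\lambda_{\min}(\theta)\ge\ell$ and $\lambda_{\max}(\theta)\le\psi$. Let $\hat\theta\in\mathcal M_+$ be a minimizer of $\phi_\alpha$ over $\mathcal M_+$. For $\gamma>0$ and $\theta\in\mathcal M$ let $$\mathrm{Prox}_\gamma(\theta;\alpha)=\operatorname*{argmin}_{u\in\mathcal M}\Big\{g_\alpha(u)+\tfrac{1}{2\gamma}\|u-\theta\|_F^2\Big\}.$$ Fix $\gamma>0$, positive integers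 $N_1,N_2,\dots$ and a deterministic $\theta_0\in\mathcal M_+$. Let $\{\theta_k,\ k\ge0\}$ be the stochastic process started at $\theta_0$ such that, for each $k\ge1$, as long as $\theta_0,\dots,\theta_{k-1}$ are positive definite, conditionally on $\sigma(\theta_0,\dots,\theta_{k-1})$ one draws $z_1,\dots,z_{N_k}$ i.i.d. from $\mathbf N(0,\theta_{k-1}^{-1})$ and sets $$\Sigma_k=\frac1{N_k}\sum_{j=1}^{N_k}z_jz_j',\qquad \theta_k=\mathrm{Prox}_\gamma\big(\theta_{k-1}-\gamma(S-\Sigma_k);\alpha\big)$$ (once an iterate fails to be positive definite, the process is continued arbitrarily). Let $\tau(\ell,\psi)=\inf\{k\ge0:\theta_k\notin\mathcal M_+(\ell,\psi)\}$, with $\inf\emptyset=\infty$. Suppose that $0<\ell\le\psi\le\infty$, that $\theta_0,\hat\theta\in\mathcal M_+(\ell,\psi)$, and that $\gamma\le\ell^2$. Then, for every $k\ge0$, $$\mathbb E\Big[\mathbf 1_{\{\tau(\ell,\psi)>k\}}\|\theta_k-\hat\theta\|_F^2\Big]\le\Big(1-\frac{\gamma}{\psi^2}\Big)^k\|\theta_0-\hat\theta\|_F^2+2\gamma^2\ell^{-2}(p+p^2)\sum_{j=1}^kN_j^{-1}\Big(1-\frac{\gamma}{\psi^2}\Big)^{k-j},$$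 where $\gamma/\psi^2=0$ if $\psi=\infty$, and $0^0=1$. In particular, the expectation is finite. -/

import Mathlib

open MeasureTheory ProbabilityTheory
open scoped ENNReal

noncomputable section

namespace StochGlasso

/-- The inner product `⟨A, B⟩ = Tr(Aᵀ B)` on `p × p` real matrices. -/
def frobInner {p : ℕ} (A B : Matrix (Fin p) (Fin p) ℝ) : ℝ :=
  (A.transpose * B).trace

/-- The Frobenius norm. -/
def frobNorm {p : ℕ} (A : Matrix (Fin p) (Fin p) ℝ) : ℝ :=
  Real.sqrt (frobInner A A)

/-- The set `M₊(ℓ, ψ)` of (symmetric) positive definite matrices all of whose eigenvalues lie in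
`[ℓ, ψ]`, where `0 < ℓ` and `ψ ≤ ∞`. -/
def boundedPD {p : ℕ} (l : ℝ) (ψ : ℝ≥0∞) : Set (Matrix (Fin p) (Fin p) ℝ) :=
  {θ | θ.PosDef ∧ ∀ t ∈ spectrum ℝ θ, l ≤ t ∧ ENNReal.ofReal t ≤ ψ}

/-- The elastic net penalty `g_α(θ) = ∑ᵢⱼ (α λ |θᵢⱼ| + (1 - α) / 2 * λ θᵢⱼ²)`. -/
def elasticNet {p : ℕ} (lam α : ℝ) (θ : Matrix (Fin p) (Fin p) ℝ) : ℝ :=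
  ∑ i, ∑ j, (α * lam * |θ i j| + (1 - α) / 2 * lam * θ i j ^ 2)

/-- The objective `φ_α(θ) = - log det θ + Tr(θ S) + g_α(θ)`, used on positive definite matrices. -/
def objective {p : ℕ} (S : Matrix (Fin p) (Fin p) ℝ) (lam α : ℝ)
    (θ : Matrix (Fin p) (Fin p) ℝ) : ℝ :=
  - Real.log θ.det + (θ * S).trace + elasticNet lam α θ

/-- `θ` minimizes the objective over all positive definite matrices. -/
def IsSolution {p : ℕ} (S : Matrix (Fin p) (Fin p) ℝ) (lam α : ℝ)
    (θ : Matrix (Fin p) (Fin p) ℝ) : Prop :=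
  θ.PosDef ∧ IsMinOn (objective S lam α) {u | u.PosDef} θ

/-- `v = Prox_γ(θ; α)`: `v` minimizes `u ↦ g_α(u) + ‖u - θ‖_F² / (2 γ)` over symmetric matrices.
The functional is strictly convex and coercive, so there is exactly one such `v`. -/
def IsProx {p : ℕ} (lam α γ : ℝ) (θ v : Matrix (Fin p) (Fin p) ℝ) : Prop :=
  v.IsSymm ∧
    IsMinOn (fun u => elasticNet lam α u + 1 / (2 * γ) * frobNorm (u - θ) ^ 2) {u | u.IsSymm} v

/-- `N⁻¹ ∑ⱼ zⱼ zⱼᵀ`. -/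
def sampleCov {p N : ℕ} (z : Fin N → EuclideanSpace ℝ (Fin p)) : Matrix (Fin p) (Fin p) ℝ :=
  (N : ℝ)⁻¹ • ∑ j, Matrix.vecMulVec (z j) (z j)

/-- The law of `N` independent draws from the normal distribution with mean zero and covariance
`C`. -/
def gaussianSample {p : ℕ} (N : ℕ) (C : Matrix (Fin p) (Fin p) ℝ) :
    Measure (Fin N → EuclideanSpace ℝ (Fin p)) :=
  Measure.pi fun _ => multivariateGaussian 0 C

/-- The sigma-algebra generated by (the entries of) `θ₀, …, θ_k`. -/
@[reducible]
def history {Ω : Type*} {p : ℕ} (θ : ℕ → Ω → Matrix (Fin p) (Fin p) ℝ) (k : ℕ) :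
    MeasurableSpace Ω :=
  ⨆ (m : Fin (k + 1)) (i : Fin p) (j : Fin p),
    MeasurableSpace.comap (fun ω => θ m ω i j) inferInstance

/-- `θ` is the stochastic proximal gradient process with step size `γ`, batch sizes `N₁, N₂, …`,
initial point `θ₀`, where `z k` is the batch drawn at step `k ≥ 1`.

Step `k + 1` draws, conditionally on `σ(θ₀, …, θ_k)`, `N_{k+1}` independent normal vectors with
mean zero and covariance `θ_k⁻¹`, and sets `θ_{k+1} = Prox_γ(θ_k - γ (S - Σ_{k+1}); α)`. The draw
only makes sense as long as the iterates are positive definite; both rules are therefore imposed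
as long as `θ₀, …, θ_k` are all positive definite, and how the process is continued otherwise is
left free. -/
structure IsStochProxProcess {Ω : Type*} [MeasurableSpace Ω] {p : ℕ} (P : Measure Ω) (S : Matrix (Fin p) (Fin p) ℝ)
    (lam α γ : ℝ) (N : ℕ → ℕ) (θ₀ : Matrix (Fin p) (Fin p) ℝ)
    (z : (k : ℕ) → Fin (N k) → Ω → EuclideanSpace ℝ (Fin p))
    (θ : ℕ → Ω → Matrix (Fin p) (Fin p) ℝ) : Prop where
  measurable_z : ∀ k i, Measurable (z k i)
  measurable_theta : ∀ k i j, Measurable fun ω => θ k ω i j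
  init : ∀ᵐ ω ∂P, θ 0 ω = θ₀
  draw : ∀ (k : ℕ) (B : Set (Fin (N (k + 1)) → EuclideanSpace ℝ (Fin p))), MeasurableSet B →
    ∀ᵐ ω ∂P, (∀ j ≤ k, (θ j ω).PosDef) →
      (P⟦{ω' | (fun i => z (k + 1) i ω') ∈ B} | history θ k⟧) ω
        = (gaussianSample (N (k + 1)) (θ k ω)⁻¹).real B
  step : ∀ k, ∀ᵐ ω ∂P, (∀ j ≤ k, (θ j ω).PosDef) →
    IsProx lam α γ (θ k ω - γ • (S - sampleCov fun i => z (k + 1) i ω)) (θ (k + 1) ω)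

/-- `τ(ℓ, ψ) = inf {k ≥ 0 : θ_k ∉ M₊(ℓ, ψ)}`, with `inf ∅ = ∞`. -/
def exitTime {Ω : Type*} {p : ℕ} (θ : ℕ → Ω → Matrix (Fin p) (Fin p) ℝ) (l : ℝ) (ψ : ℝ≥0∞) :
    Ω → WithTop ℕ :=
  hittingAfter θ (boundedPD l ψ)ᶜ 0

/-- The factor `1 - γ / ψ²`, equal to `1` when `ψ = ∞`. -/
def rate (γ : ℝ) (ψ : ℝ≥0∞) : ℝ :=
  1 - (ENNReal.ofReal γ / ψ ^ 2).toReal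

end StochGlasso

end

/-! The proof compares each iterate with `θhat` and separates drift from noise. The solution
satisfies a first-order variational inequality, which makes it a fixed point of the exact proximal
gradient step, and the proximal map is nonexpansive. So the distance from the new iterate to `θhat`
is at most that between the two arguments of the prox, namely the norm of `(θ_k - θhat) + γ (Σ_{k+1}
- θhat⁻¹)` (`IsProx.frobNorm_sq_sub_solution_le`).

Given the past, `Σ_{k+1}` has mean `θ_k⁻¹`, so the conditional second moment of that norm is a
squared drift plus a variance, without cross term. The drift `(A - B) + γ (A⁻¹ - B⁻¹)` contracts:
since `A⁻¹ - B⁻¹ = -A⁻¹ (A - B) B⁻¹`, in eigenbases of `A` and `B` it multiplies entries by `1 - γ /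
(dᵢ eⱼ)`, which lies in `[0, 1]` because `γ ≤ l²` (`frobNorm_sq_gradient_step_le`). The variance is
controlled by Gaussian fourth moments and by the eigenvalues of `θ_k⁻¹` being at most `1 / l`.

On `{τ > k}` the past iterates are positive definite, so the conditional law of the batch is the
prescribed Gaussian one; as `{τ > k + 1} ⊆ {τ > k}`, this gives a linear recursion, which is
unrolled. -/

namespace StochGlasso

/-! ### Gaussian moments of order four -/

lemma integral_pow_four_gaussianReal (v : NNReal) :
    ∫ x, x ^ 4 ∂gaussianReal 0 v = 3 * (v : ℝ) ^ 2 := by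
  have h := iteratedDeriv_mgf_zero (X := fun x : ℝ => x) (μ := gaussianReal 0 v) (by simp) 4
  have h' : ∫ x, x ^ 4 ∂gaussianReal 0 v = iteratedDeriv 4 (mgf (fun x : ℝ => x) (gaussianReal 0 v)) 0 := by
    rw [h]; rfl
  rw [h', mgf_fun_id_gaussianReal]
  simp only [zero_mul, zero_add]
  set c : ℝ := (v : ℝ)
  have e : ∀ t : ℝ, HasDerivAt (fun t => Real.exp (c * t ^ 2 / 2))
      (c * t * Real.exp (c * t ^ 2 / 2)) t := fun t => by
    have h1 : HasDerivAt (fun t : ℝ => c * t ^ 2 / 2) (c * t) t := by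
      convert! (((hasDerivAt_pow 2 t).const_mul c).div_const 2) using 1
      norm_num; ring
    convert! h1.exp using 1
    ring
  -- Each derivative of the moment generating function is a polynomial times the same exponential;
  -- differentiating replaces `q` by `q' + c t q`.
  have d : ∀ (q q' : ℝ → ℝ), (∀ t, HasDerivAt q (q' t) t) →
      deriv (fun t => q t * Real.exp (c * t ^ 2 / 2))
        = fun t => (q' t + q t * (c * t)) * Real.exp (c * t ^ 2 / 2) := fun q q' hq => by
    ext t
    rw [((hq t).fun_mul (e t)).deriv]; ring
  have d1 : deriv (fun t => Real.exp (c * t ^ 2 / 2))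
      = fun t => (c * t) * Real.exp (c * t ^ 2 / 2) := by
    ext t; rw [(e t).deriv]
  have d2 := d (fun t => c * t) (fun _ => c) fun t => by
    simpa using (hasDerivAt_id t).const_mul c
  have d3 := d (fun t => c + c * t * (c * t)) (fun t => 2 * c ^ 2 * t) fun t => by
    have := ((hasDerivAt_pow 2 t).const_mul (c ^ 2)).const_add c
    convert! this using 1
    · ext t; ring
    · norm_num; ring
  have d4 := d (fun t => 2 * c ^ 2 * t + (c + c * t * (c * t)) * (c * t))
      (fun t => 3 * c ^ 2 + 3 * c ^ 3 * t ^ 2) fun t => by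
    have := ((hasDerivAt_id t).const_mul (3 * c ^ 2)).add ((hasDerivAt_pow 3 t).const_mul (c ^ 3))
    convert! this using 1
    · ext t; simp; ring
    · norm_num; ring
  rw [iteratedDeriv_succ, iteratedDeriv_succ, iteratedDeriv_succ, iteratedDeriv_one, d1, d2, d3, d4]
  simp

variable {ι : Type*} [Fintype ι]

/-- Every linear image of a Gaussian measure is a real Gaussian, so the scalar fourth moment
applies. -/
lemma integral_dual_pow_four (μ : Measure (EuclideanSpace ℝ ι)) [IsGaussian μ]
    (L : StrongDual ℝ (EuclideanSpace ℝ ι)) (hL : ∫ x, L x ∂μ = 0) :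
    ∫ x, L x ^ 4 ∂μ = 3 * (∫ x, L x ^ 2 ∂μ) ^ 2 := by
  have h := IsGaussian.map_eq_gaussianReal (μ := μ) L
  have h4 := integral_pow_four_gaussianReal (Var[L; μ]).toNNReal
  rw [hL] at h
  rw [← h, integral_map (by fun_prop) (by fun_prop),
    Real.coe_toNNReal _ (variance_nonneg _ _), variance_of_integral_eq_zero (by fun_prop) hL] at h4
  exact h4

variable [DecidableEq ι]

lemma memLp_eval_multivariateGaussian (C : Matrix ι ι ℝ) (i : ι) (q : ℝ≥0∞) (hq : q ≠ ∞) :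
    MemLp (fun x : EuclideanSpace ℝ ι => x i) q (multivariateGaussian 0 C) :=
  (EuclideanSpace.proj i : StrongDual ℝ (EuclideanSpace ℝ ι)).comp_memLp'
    (IsGaussian.memLp_id (multivariateGaussian 0 C) q hq)

lemma integral_eval_multivariateGaussian (C : Matrix ι ι ℝ) (i : ι) :
    ∫ x : EuclideanSpace ℝ ι, x i ∂multivariateGaussian 0 C = 0 := by
  have := IsGaussian.integral_dual (μ := multivariateGaussian (0 : EuclideanSpace ℝ ι) C)
    (EuclideanSpace.proj i)
  simpa using this

lemma integral_eval_mul_eval_multivariateGaussian {C : Matrix ι ι ℝ} (hC : C.PosSemidef) (i j : ι) :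
    ∫ x : EuclideanSpace ℝ ι, x i * x j ∂multivariateGaussian 0 C = C i j := by
  rw [← covariance_eval_multivariateGaussian (μ := 0) hC i j, covariance]
  simp [integral_eval_multivariateGaussian]

/-- A case of Wick's formula, obtained by polarization: the fourth moments of the linear forms `a xᵢ
+ b xⱼ` determine the mixed one. The case `i = j` is included. -/
lemma integral_sq_eval_mul_sq_eval_multivariateGaussian {C : Matrix ι ι ℝ} (hC : C.PosSemidef)
    (i j : ι) :
    Integrable (fun x : EuclideanSpace ℝ ι => x i ^ 2 * x j ^ 2) (multivariateGaussian 0 C) ∧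
      ∫ x : EuclideanSpace ℝ ι, x i ^ 2 * x j ^ 2 ∂multivariateGaussian 0 C
        = C i i * C j j + 2 * C i j ^ 2 := by
  set μ := multivariateGaussian (0 : EuclideanSpace ℝ ι) C
  have hm : ∀ k, MemLp (fun x : EuclideanSpace ℝ ι => x k) 4 μ := fun k =>
    memLp_eval_multivariateGaussian C k 4 (by simp)
  have hm2 : ∀ k, MemLp (fun x : EuclideanSpace ℝ ι => x k) 2 μ := fun k =>
    memLp_eval_multivariateGaussian C k 2 (by simp)
  have hI1 : ∀ k, Integrable (fun x : EuclideanSpace ℝ ι => x k) μ := fun k =>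
    (hm2 k).integrable (by norm_num)
  have hsq : ∀ a b : ℝ, Integrable (fun x : EuclideanSpace ℝ ι => (a * x i + b * x j) ^ 4) μ := by
    intro a b
    have := (((hm i).const_mul a).add ((hm j).const_mul b)).integrable_norm_pow (p := 4) (by simp)
    refine this.congr (Filter.Eventually.of_forall fun x => ?_)
    simp only [Pi.add_apply, Real.norm_eq_abs, (by decide : Even 4).pow_abs]
  have key : ∀ a b : ℝ, ∫ x : EuclideanSpace ℝ ι, (a * x i + b * x j) ^ 4 ∂μ
      = 3 * (a ^ 2 * C i i + 2 * a * b * C i j + b ^ 2 * C j j) ^ 2 := by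
    intro a b
    let L : StrongDual ℝ (EuclideanSpace ℝ ι) :=
      a • EuclideanSpace.proj i + b • EuclideanSpace.proj j
    have hLx : ∀ x, L x = a * x i + b * x j := fun x => by simp [L]
    have h0 : ∫ x, L x ∂μ = 0 := by
      simp_rw [hLx]
      rw [integral_add ((hI1 i).const_mul a) ((hI1 j).const_mul b), integral_const_mul,
        integral_const_mul, integral_eval_multivariateGaussian, integral_eval_multivariateGaussian]
      simp
    have h4 := integral_dual_pow_four μ L h0
    simp_rw [hLx] at h4
    rw [h4]
    have h2 : ∫ x : EuclideanSpace ℝ ι, (a * x i + b * x j) ^ 2 ∂μ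
        = a ^ 2 * C i i + 2 * a * b * C i j + b ^ 2 * C j j := by
      have e : (fun x : EuclideanSpace ℝ ι => (a * x i + b * x j) ^ 2) = fun x =>
          a ^ 2 * (x i * x i) + 2 * a * b * (x i * x j) + b ^ 2 * (x j * x j) := by
        ext x; ring
      have hp : ∀ k m, Integrable (fun x : EuclideanSpace ℝ ι => x k * x m) μ := fun k m =>
        (hm2 k).integrable_mul (hm2 m)
      have hA : Integrable (fun x : EuclideanSpace ℝ ι =>
          a ^ 2 * (x i * x i) + 2 * a * b * (x i * x j)) μ :=
        ((hp i i).const_mul _).add ((hp i j).const_mul _)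
      rw [e, integral_add hA ((hp j j).const_mul _), integral_add ((hp i i).const_mul _) ((hp i j).const_mul _)]
      simp_rw [integral_const_mul]
      rw [integral_eval_mul_eval_multivariateGaussian hC,
        integral_eval_mul_eval_multivariateGaussian hC,
        integral_eval_mul_eval_multivariateGaussian hC]
    rw [h2]
  -- `x² y² = ((x + y)⁴ + (x - y)⁴) / 12 - (x⁴ + y⁴) / 6`, with the coefficients `1`, `-1`, `0` kept
  -- explicit to match `hsq` and `key`.
  have e : (fun x : EuclideanSpace ℝ ι => x i ^ 2 * x j ^ 2) = fun x =>
      (1 / 12) * ((1 * x i + 1 * x j) ^ 4 + (1 * x i + (-1) * x j) ^ 4)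
        + (-(1 / 6)) * ((1 * x i + 0 * x j) ^ 4 + (0 * x i + 1 * x j) ^ 4) := by
    ext x; ring
  have hA : ∀ a b c d s : ℝ, Integrable (fun x : EuclideanSpace ℝ ι =>
      s * ((a * x i + b * x j) ^ 4 + (c * x i + d * x j) ^ 4)) μ := fun a b c d s =>
    ((hsq a b).add (hsq c d)).const_mul s
  refine ⟨by rw [e]; exact (hA _ _ _ _ _).add (hA _ _ _ _ _), ?_⟩
  rw [e, integral_add (hA _ _ _ _ _) (hA _ _ _ _ _),
    integral_const_mul, integral_const_mul, integral_add (hsq _ _) (hsq _ _),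
    integral_add (hsq _ _) (hsq _ _), key, key, key, key]
  ring

end StochGlasso

/-! ### Frobenius norm, mean and variance of the sample covariance -/

namespace StochGlasso

variable {p : ℕ}

lemma frobInner_eq_sum (A B : Matrix (Fin p) (Fin p) ℝ) :
    frobInner A B = ∑ i, ∑ j, A i j * B i j := by
  simp only [frobInner, Matrix.trace, Matrix.diag_apply, Matrix.mul_apply, Matrix.transpose_apply]
  exact Finset.sum_comm

lemma frobInner_self_nonneg (A : Matrix (Fin p) (Fin p) ℝ) : 0 ≤ frobInner A A := by
  rw [frobInner_eq_sum]
  exact Finset.sum_nonneg fun i _ => Finset.sum_nonneg fun j _ => mul_self_nonneg _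

lemma frobNorm_sq (A : Matrix (Fin p) (Fin p) ℝ) : frobNorm A ^ 2 = frobInner A A :=
  Real.sq_sqrt (frobInner_self_nonneg A)

lemma frobNorm_sq_eq_sum (A : Matrix (Fin p) (Fin p) ℝ) :
    frobNorm A ^ 2 = ∑ i, ∑ j, A i j ^ 2 := by
  rw [frobNorm_sq, frobInner_eq_sum]
  simp only [sq]

instance isProbabilityMeasure_gaussianSample (N : ℕ) (C : Matrix (Fin p) (Fin p) ℝ) :
    IsProbabilityMeasure (gaussianSample N C) := by
  unfold gaussianSample; infer_instance

lemma sampleCov_apply {N : ℕ} (z : Fin N → EuclideanSpace ℝ (Fin p)) (i j : Fin p) :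
    sampleCov z i j = (N : ℝ)⁻¹ * ∑ n, z n i * z n j := by
  simp [sampleCov, Matrix.sum_apply, Matrix.vecMulVec_apply]

lemma memLp_eval_mul_eval {C : Matrix (Fin p) (Fin p) ℝ} (hC : C.PosSemidef) (i j : Fin p) :
    MemLp (fun x : EuclideanSpace ℝ (Fin p) => x i * x j) 2 (multivariateGaussian 0 C) := by
  rw [memLp_two_iff_integrable_sq (by fun_prop)]
  simpa only [mul_pow] using (integral_sq_eval_mul_sq_eval_multivariateGaussian hC i j).1

lemma memLp_sampleCov {C : Matrix (Fin p) (Fin p) ℝ} (hC : C.PosSemidef) (N : ℕ) (i j : Fin p) :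
    MemLp (fun z => sampleCov z i j) 2 (gaussianSample N C) := by
  have h : ∀ n : Fin N, MemLp (fun z : Fin N → EuclideanSpace ℝ (Fin p) => z n i * z n j) 2
      (gaussianSample N C) := fun n =>
    (memLp_eval_mul_eval hC i j).comp_measurePreserving
      (measurePreserving_eval (fun _ => multivariateGaussian 0 C) n)
  have h' : MemLp (fun z : Fin N → EuclideanSpace ℝ (Fin p) => ∑ n, z n i * z n j) 2
      (gaussianSample N C) := memLp_finsetSum _ fun n _ => h n
  simp only [sampleCov_apply]
  exact h'.const_mul _

lemma integral_sampleCov {C : Matrix (Fin p) (Fin p) ℝ} (hC : C.PosSemidef) {N : ℕ} (hN : 0 < N)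
    (i j : Fin p) :
    ∫ z, sampleCov z i j ∂gaussianSample N C = C i j := by
  simp only [sampleCov_apply]
  have hmp := fun n : Fin N => measurePreserving_eval (fun _ => multivariateGaussian 0 C) n
  have hint := (memLp_eval_mul_eval hC i j).integrable (by norm_num)
  have hint' : ∀ n : Fin N, Integrable (fun z : Fin N → EuclideanSpace ℝ (Fin p) => z n i * z n j)
      (gaussianSample N C) := fun n => (hmp n).integrable_comp_of_integrable hint
  rw [integral_const_mul, integral_finsetSum _ fun n _ => hint' n]
  have : ∀ n : Fin N, ∫ z : Fin N → EuclideanSpace ℝ (Fin p), z n i * z n j ∂gaussianSample N C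
      = C i j := fun n => by
    rw [← integral_eval_mul_eval_multivariateGaussian hC i j, ← (hmp n).map_eq,
      integral_map (hmp n).measurable.aemeasurable (by fun_prop)]
    rfl
  simp only [this, Finset.sum_const, Finset.card_univ, Fintype.card_fin, nsmul_eq_mul]
  field_simp

lemma variance_sampleCov_le {C : Matrix (Fin p) (Fin p) ℝ} (hC : C.PosSemidef) {N : ℕ} (hN : 0 < N)
    (i j : Fin p) :
    Var[fun z => sampleCov z i j; gaussianSample N C]
      ≤ (N : ℝ)⁻¹ * (C i i * C j j + 2 * C i j ^ 2) := by
  have hv : Var[fun x : EuclideanSpace ℝ (Fin p) => x i * x j; multivariateGaussian 0 C]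
      ≤ C i i * C j j + 2 * C i j ^ 2 := by
    -- Bounding the variance by the second moment gives up one `C i j ^ 2`.
    refine (variance_le_expectation_sq (by fun_prop)).trans_eq ?_
    rw [← (integral_sq_eval_mul_sq_eval_multivariateGaussian hC i j).2]
    simp [mul_pow]
  have hs : Var[∑ n : Fin N, fun z : Fin N → EuclideanSpace ℝ (Fin p) => z n i * z n j;
      gaussianSample N C]
      = ∑ n : Fin N, Var[fun x : EuclideanSpace ℝ (Fin p) => x i * x j;
          multivariateGaussian 0 C] :=
    variance_sum_pi (μ := fun _ : Fin N => multivariateGaussian 0 C)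
      (X := fun _ x => x i * x j) fun _ => memLp_eval_mul_eval hC i j
  have e : (fun z : Fin N → EuclideanSpace ℝ (Fin p) => sampleCov z i j) = fun z => (N : ℝ)⁻¹ *
      (∑ n : Fin N, fun z : Fin N → EuclideanSpace ℝ (Fin p) => z n i * z n j) z := by
    ext z; simp [sampleCov_apply]
  rw [e, variance_const_mul, hs]
  simp only [Finset.sum_const, Finset.card_univ, Fintype.card_fin, nsmul_eq_mul]
  calc _ = (N : ℝ)⁻¹ * Var[fun x : EuclideanSpace ℝ (Fin p) => x i * x j;
          multivariateGaussian 0 C] := by field_simp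
    _ ≤ _ := by gcongr

/-- Entrywise, second moment equals squared mean plus variance; since `sampleCov` is unbiased, the
mean is `M` and no cross term appears. The sum of `C i i * C j j` is the squared trace. -/
lemma integral_sq_frobNorm_add_sampleCov_le {C : Matrix (Fin p) (Fin p) ℝ} (hC : C.PosSemidef)
    {N : ℕ} (hN : 0 < N) (M : Matrix (Fin p) (Fin p) ℝ) (γ : ℝ) :
    Integrable (fun z => frobNorm (M + γ • (sampleCov z - C)) ^ 2) (gaussianSample N C) ∧
      ∫ z, frobNorm (M + γ • (sampleCov z - C)) ^ 2 ∂gaussianSample N C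
        ≤ frobNorm M ^ 2 + γ ^ 2 * ((N : ℝ)⁻¹ * (C.trace ^ 2 + 2 * frobNorm C ^ 2)) := by
  have hY : ∀ i j, MemLp (fun z => M i j + γ * (sampleCov z i j - C i j)) 2 (gaussianSample N C) := by
    intro i j
    have h1 : MemLp (fun z => sampleCov z i j - C i j) 2 (gaussianSample N C) :=
      (memLp_sampleCov hC N i j).sub (memLp_const _)
    have h2 : MemLp (fun z => γ * (sampleCov z i j - C i j)) 2 (gaussianSample N C) :=
      h1.const_mul γ
    exact (memLp_const (M i j)).add h2
  have hm : ∀ i j, ∫ z, (M i j + γ * (sampleCov z i j - C i j)) ∂gaussianSample N C = M i j := by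
    intro i j
    have h1 : Integrable (fun z => sampleCov z i j) (gaussianSample N C) :=
      (memLp_sampleCov hC N i j).integrable (by norm_num)
    have h2 : Integrable (fun z => sampleCov z i j - C i j) (gaussianSample N C) :=
      h1.sub (integrable_const _)
    rw [integral_add (integrable_const _) (h2.const_mul _), integral_const_mul,
      integral_sub h1 (integrable_const _), integral_sampleCov hC hN]
    simp
  have hv : ∀ i j, ∫ z, (M i j + γ * (sampleCov z i j - C i j)) ^ 2 ∂gaussianSample N C
      ≤ M i j ^ 2 + γ ^ 2 * ((N : ℝ)⁻¹ * (C i i * C j j + 2 * C i j ^ 2)) := by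
    intro i j
    have hae : AEStronglyMeasurable (fun z => sampleCov z i j) (gaussianSample N C) :=
      (memLp_sampleCov hC N i j).1
    have h := variance_eq_sub (hY i j)
    rw [hm, variance_const_add (by fun_prop), variance_const_mul, variance_sub_const hae] at h
    have h' := mul_le_mul_of_nonneg_left (variance_sampleCov_le hC hN i j) (sq_nonneg γ)
    simp only [Pi.pow_apply] at h
    linarith
  simp only [frobNorm_sq_eq_sum, Matrix.add_apply, Matrix.smul_apply, Matrix.sub_apply, smul_eq_mul]
  refine ⟨integrable_finsetSum _ fun i _ => integrable_finsetSum _ fun j _ =>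
    (hY i j).integrable_sq, ?_⟩
  rw [integral_finsetSum _ fun i _ => integrable_finsetSum _ fun j _ => (hY i j).integrable_sq]
  simp_rw [integral_finsetSum _ fun j _ => (hY _ j).integrable_sq]
  refine (Finset.sum_le_sum fun i _ => Finset.sum_le_sum fun j _ => hv i j).trans_eq ?_
  simp only [Finset.sum_add_distrib, ← Finset.mul_sum, ← Finset.sum_mul, Matrix.trace,
    Matrix.diag_apply, sq (∑ i, C i i)]

end StochGlasso

/-! ### Spectral estimates on `boundedPD l ψ` -/

namespace StochGlasso

variable {p : ℕ}

lemma exists_orthogonal_diagonalization {A : Matrix (Fin p) (Fin p) ℝ} (hA : A.IsHermitian) :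
    ∃ U : Matrix (Fin p) (Fin p) ℝ, U.transpose * U = 1 ∧ U * U.transpose = 1 ∧
      A = U * Matrix.diagonal hA.eigenvalues * U.transpose := by
  refine ⟨hA.eigenvectorUnitary, ?_, ?_, ?_⟩
  · rw [← Matrix.conjTranspose_eq_transpose_of_trivial]
    exact Unitary.coe_star_mul_self hA.eigenvectorUnitary
  · rw [← Matrix.conjTranspose_eq_transpose_of_trivial]
    exact Unitary.coe_mul_star_self hA.eigenvectorUnitary
  · have h := hA.spectral_theorem
    rw [Unitary.conjStarAlgAut_apply] at h
    rw [← Matrix.conjTranspose_eq_transpose_of_trivial]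
    exact h

lemma exists_diagonalization_of_mem_boundedPD {l : ℝ} {ψ : ℝ≥0∞} {A : Matrix (Fin p) (Fin p) ℝ}
    (hA : A ∈ boundedPD l ψ) :
    ∃ (U : Matrix (Fin p) (Fin p) ℝ) (d : Fin p → ℝ), U.transpose * U = 1 ∧ U * U.transpose = 1 ∧
      A = U * Matrix.diagonal d * U.transpose ∧ ∀ i, l ≤ d i ∧ ENNReal.ofReal (d i) ≤ ψ := by
  obtain ⟨U, h1, h2, h3⟩ := exists_orthogonal_diagonalization hA.1.1
  exact ⟨U, _, h1, h2, h3, fun i => hA.2 _ (hA.1.1.eigenvalues_mem_spectrum_real i)⟩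

lemma inv_eq_of_diagonalization {U A : Matrix (Fin p) (Fin p) ℝ} {d : Fin p → ℝ}
    (h1 : U.transpose * U = 1) (h2 : U * U.transpose = 1)
    (hA : A = U * Matrix.diagonal d * U.transpose) (hd : ∀ i, d i ≠ 0) :
    A⁻¹ = U * Matrix.diagonal (fun i => (d i)⁻¹) * U.transpose := by
  refine Matrix.inv_eq_right_inv ?_
  rw [hA]
  calc U * Matrix.diagonal d * U.transpose * (U * Matrix.diagonal (fun i => (d i)⁻¹) * U.transpose)
      = U * (Matrix.diagonal d * (U.transpose * U) * Matrix.diagonal (fun i => (d i)⁻¹))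
          * U.transpose := by simp only [Matrix.mul_assoc]
    _ = 1 := by
      rw [h1, Matrix.mul_one, Matrix.diagonal_mul_diagonal]
      simp [hd, h2]

lemma frobNorm_sq_mul_mul_transpose {U V : Matrix (Fin p) (Fin p) ℝ} (hU : U.transpose * U = 1)
    (hV : V.transpose * V = 1) (X : Matrix (Fin p) (Fin p) ℝ) :
    frobNorm (U * X * V.transpose) ^ 2 = frobNorm X ^ 2 := by
  rw [frobNorm_sq, frobNorm_sq, frobInner, frobInner]
  calc ((U * X * V.transpose).transpose * (U * X * V.transpose)).trace
      = (V * (X.transpose * (U.transpose * U) * X) * V.transpose).trace := by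
        simp only [Matrix.transpose_mul, Matrix.transpose_transpose, Matrix.mul_assoc]
    _ = _ := by
      rw [hU, Matrix.mul_one, Matrix.trace_mul_comm, ← Matrix.mul_assoc, hV, Matrix.one_mul]

lemma toReal_ofReal_div_sq_le {γ d e : ℝ} {ψ : ℝ≥0∞} (hγ : 0 ≤ γ) (hd : 0 < d) (he : 0 < e)
    (hdψ : ENNReal.ofReal d ≤ ψ) (heψ : ENNReal.ofReal e ≤ ψ) :
    (ENNReal.ofReal γ / ψ ^ 2).toReal ≤ γ / (d * e) := by
  rcases eq_or_ne ψ ⊤ with rfl | hψ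
  · simp; positivity
  · rw [ENNReal.ofReal_le_iff_le_toReal hψ] at hdψ heψ
    rw [ENNReal.toReal_div, ENNReal.toReal_ofReal hγ, ENNReal.toReal_pow, sq]
    gcongr

lemma rate_nonneg {γ l : ℝ} {ψ : ℝ≥0∞} (hγ : 0 ≤ γ) (hl : 0 < l) (hlψ : ENNReal.ofReal l ≤ ψ)
    (hγl : γ ≤ l ^ 2) : 0 ≤ rate γ ψ := by
  have h := toReal_ofReal_div_sq_le hγ hl hl hlψ hlψ
  have : γ / (l * l) ≤ 1 := by rw [div_le_one (by positivity)]; linarith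
  unfold rate; linarith

/-- From `γ ≤ l² ≤ d e` the base lies in `[0, 1]`, so its square is at most itself, and `d e ≤ ψ²`
bounds it by the rate. -/
lemma sq_one_sub_le_rate {γ l d e : ℝ} {ψ : ℝ≥0∞} (hγ : 0 ≤ γ) (hl : 0 < l) (hγl : γ ≤ l ^ 2)
    (hd : l ≤ d) (he : l ≤ e) (hdψ : ENNReal.ofReal d ≤ ψ) (heψ : ENNReal.ofReal e ≤ ψ) :
    (1 - γ * (d⁻¹ * e⁻¹)) ^ 2 ≤ rate γ ψ := by
  have hd0 := hl.trans_le hd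
  have he0 := hl.trans_le he
  have h := toReal_ofReal_div_sq_le hγ hd0 he0 hdψ heψ
  have h1 : γ / (d * e) ≤ 1 := by
    rw [div_le_one (by positivity)]
    nlinarith [mul_le_mul hd he hl.le hd0.le]
  have h0 : 0 ≤ γ / (d * e) := by positivity
  rw [show γ * (d⁻¹ * e⁻¹) = γ / (d * e) by field_simp]
  unfold rate
  nlinarith

/-- The gradient step of `θ ↦ -log det θ + Tr (θ S)` contracts on `boundedPD l ψ`. -/
lemma frobNorm_sq_gradient_step_le {γ l : ℝ} {ψ : ℝ≥0∞} (hγ : 0 ≤ γ) (hl : 0 < l)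
    (hγl : γ ≤ l ^ 2) {A B : Matrix (Fin p) (Fin p) ℝ} (hA : A ∈ boundedPD l ψ)
    (hB : B ∈ boundedPD l ψ) :
    frobNorm ((A - B) + γ • (A⁻¹ - B⁻¹)) ^ 2 ≤ rate γ ψ * frobNorm (A - B) ^ 2 := by
  obtain ⟨U, d, hU1, hU2, hAd, hd⟩ := exists_diagonalization_of_mem_boundedPD hA
  obtain ⟨V, e, hV1, hV2, hBe, he⟩ := exists_diagonalization_of_mem_boundedPD hB
  have hAi := inv_eq_of_diagonalization hU1 hU2 hAd fun i => (hl.trans_le (hd i).1).ne'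
  have hBi := inv_eq_of_diagonalization hV1 hV2 hBe fun i => (hl.trans_le (he i).1).ne'
  set D := A - B with hD
  -- `A` and `B` need not commute, so rows are written in an eigenbasis of `A` and columns in one of
  -- `B`; the norm is unchanged and the step acts entry by entry.
  set E := U.transpose * D * V with hE
  have hDE : D = U * E * V.transpose := by
    calc D = (U * U.transpose) * D * (V * V.transpose) := by rw [hU2, hV2]; simp
      _ = _ := by simp only [hE, Matrix.mul_assoc]
  have hdet : ∀ {M : Matrix (Fin p) (Fin p) ℝ}, M ∈ boundedPD l ψ → IsUnit M.det := fun h =>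
    h.1.det_pos.ne'.isUnit
  have hinv : A⁻¹ - B⁻¹ = -(A⁻¹ * D * B⁻¹) := by
    rw [hD, Matrix.mul_sub, Matrix.sub_mul, Matrix.nonsing_inv_mul _ (hdet hA), Matrix.mul_assoc,
      Matrix.mul_nonsing_inv _ (hdet hB)]
    simp
  have hinvE : A⁻¹ - B⁻¹ = U * (-(Matrix.diagonal (fun i => (d i)⁻¹) * E
      * Matrix.diagonal (fun i => (e i)⁻¹))) * V.transpose := by
    rw [hinv, hAi, hBi, hE]
    simp only [Matrix.mul_neg, Matrix.neg_mul, Matrix.mul_assoc]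
  have hsum : D + γ • (A⁻¹ - B⁻¹) = U * (E + γ • (-(Matrix.diagonal (fun i => (d i)⁻¹) * E
      * Matrix.diagonal (fun i => (e i)⁻¹)))) * V.transpose := by
    rw [hinvE, Matrix.mul_add, Matrix.add_mul, ← hDE, Matrix.mul_smul, Matrix.smul_mul]
  rw [hsum, frobNorm_sq_mul_mul_transpose hU1 hV1, hDE, frobNorm_sq_mul_mul_transpose hU1 hV1,
    frobNorm_sq_eq_sum, frobNorm_sq_eq_sum, Finset.mul_sum]
  refine Finset.sum_le_sum fun i _ => ?_
  rw [Finset.mul_sum]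
  refine Finset.sum_le_sum fun j _ => ?_
  have hr := sq_one_sub_le_rate hγ hl hγl (hd i).1 (he j).1 (hd i).2 (he j).2
  calc _ = (1 - γ * ((d i)⁻¹ * (e j)⁻¹)) ^ 2 * E i j ^ 2 := by
        simp only [Matrix.add_apply, Matrix.smul_apply, Matrix.neg_apply, Matrix.mul_diagonal,
          Matrix.diagonal_mul, smul_eq_mul]
        ring
    _ ≤ _ := by gcongr

/-- The eigenvalues of `A⁻¹` are at most `l⁻¹`, which gives `(p² + 2 p) / l²`; this is enlarged to
the stated form. -/
lemma trace_sq_add_frobNorm_sq_inv_le {l : ℝ} {ψ : ℝ≥0∞} (hl : 0 < l)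
    {A : Matrix (Fin p) (Fin p) ℝ} (hA : A ∈ boundedPD l ψ) :
    A⁻¹.trace ^ 2 + 2 * frobNorm A⁻¹ ^ 2 ≤ 2 * ((l ^ 2)⁻¹ * ((p : ℝ) + (p : ℝ) ^ 2)) := by
  obtain ⟨U, d, hU1, hU2, hAd, hd⟩ := exists_diagonalization_of_mem_boundedPD hA
  rw [inv_eq_of_diagonalization hU1 hU2 hAd fun i => (hl.trans_le (hd i).1).ne']
  have hdl : ∀ i, (d i)⁻¹ ≤ l⁻¹ := fun i => inv_anti₀ hl (hd i).1
  have hd0 : ∀ i, 0 ≤ (d i)⁻¹ := fun i => inv_nonneg.2 (hl.trans_le (hd i).1).le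
  have ht : (U * Matrix.diagonal (fun i => (d i)⁻¹) * U.transpose).trace = ∑ i, (d i)⁻¹ := by
    rw [Matrix.trace_mul_comm, ← Matrix.mul_assoc, hU1, Matrix.one_mul, Matrix.trace_diagonal]
  have hf : frobNorm (U * Matrix.diagonal (fun i => (d i)⁻¹) * U.transpose) ^ 2
      = ∑ i, (d i)⁻¹ ^ 2 := by
    rw [frobNorm_sq_mul_mul_transpose hU1 hU1, frobNorm_sq_eq_sum]
    refine Finset.sum_congr rfl fun i _ => ?_
    rw [Finset.sum_eq_single i]
    · simp
    · intro j _ hj; simp [Matrix.diagonal_apply_ne' _ hj]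
    · simp
  have h1 : ∑ i, (d i)⁻¹ ≤ p * l⁻¹ := (Finset.sum_le_sum fun i _ => hdl i).trans_eq (by simp)
  have h2 : ∑ i, (d i)⁻¹ ^ 2 ≤ p * l⁻¹ ^ 2 :=
    (Finset.sum_le_sum fun i _ => pow_le_pow_left₀ (hd0 i) (hdl i) 2).trans_eq (by simp)
  have h3 := pow_le_pow_left₀ (Finset.sum_nonneg fun i _ => hd0 i) h1 2
  rw [ht, hf, ← inv_pow]
  nlinarith [sq_nonneg ((p : ℝ) * l⁻¹)]

lemma posSemidef_add_smul_one_of_diagonalization {U A : Matrix (Fin p) (Fin p) ℝ} {d : Fin p → ℝ}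
    (h2 : U * U.transpose = 1) (hA : A = U * Matrix.diagonal d * U.transpose) {c : ℝ}
    (hc : ∀ i, 0 ≤ d i + c) : (A + c • 1).PosSemidef := by
  have : A + c • 1 = U * Matrix.diagonal (fun i => d i + c) * U.transpose := by
    rw [← Matrix.diagonal_add, Matrix.mul_add, Matrix.add_mul, ← hA, ← Matrix.smul_one_eq_diagonal,
      Matrix.mul_smul, Matrix.smul_mul, Matrix.mul_one, h2]
  rw [this, ← Matrix.conjTranspose_eq_transpose_of_trivial]
  exact (Matrix.PosSemidef.diagonal fun i => hc i).mul_mul_conjTranspose_same U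

/-- Makes every symmetric direction admissible at the solution. In the semidefinite order `A ≥ l`
and `D ≥ -K`, hence `A + t D ≥ l - t K > 0` for small `t`. -/
lemma eventually_posDef_add_smul {l : ℝ} {ψ : ℝ≥0∞} (hl : 0 < l)
    {A D : Matrix (Fin p) (Fin p) ℝ} (hA : A ∈ boundedPD l ψ) (hD : D.IsHermitian) :
    ∀ᶠ t in nhdsWithin (0 : ℝ) (Set.Ioi 0), (A + t • D).PosDef := by
  obtain ⟨U, d, hU1, hU2, hAd, hd⟩ := exists_diagonalization_of_mem_boundedPD hA
  obtain ⟨V, hV1, hV2, hDe⟩ := exists_orthogonal_diagonalization hD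
  set K := ∑ i, |hD.eigenvalues i| with hK
  have hK0 : 0 ≤ K := Finset.sum_nonneg fun i _ => abs_nonneg _
  have hA' : (A + (-l) • 1).PosSemidef :=
    posSemidef_add_smul_one_of_diagonalization hU2 hAd fun i => by linarith [(hd i).1]
  have hD' : (D + K • 1).PosSemidef :=
    posSemidef_add_smul_one_of_diagonalization hV2 hDe fun i => by
      have := Finset.single_le_sum (f := fun i => |hD.eigenvalues i|)
        (fun i _ => abs_nonneg _) (Finset.mem_univ i)
      have h' := neg_abs_le (hD.eigenvalues i)
      linarith
  -- `K + 1` rather than `K`, since `K` may vanish.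
  have hlt : (0 : ℝ) < l / (K + 1) := by positivity
  filter_upwards [Ioo_mem_nhdsGT hlt] with t ht
  have htK : 0 < l - t * K := by
    have := (lt_div_iff₀ (by linarith)).1 ht.2
    nlinarith [ht.1]
  have e : A + t • D = (A + (-l) • 1) + t • (D + K • 1) + (l - t * K) • 1 := by
    ext i j
    simp only [Matrix.add_apply, Matrix.smul_apply, smul_eq_mul]
    ring
  rw [e]
  exact ((Matrix.PosDef.one).smul htK).posSemidef_add (hA'.add (hD'.smul ht.1.le))

end StochGlasso

/-! ### Variational inequalities and nonexpansiveness of the prox -/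

namespace StochGlasso

variable {p : ℕ}

lemma frobInner_comm (A B : Matrix (Fin p) (Fin p) ℝ) : frobInner A B = frobInner B A := by
  simp only [frobInner_eq_sum, mul_comm]

lemma frobInner_add_right (A B C : Matrix (Fin p) (Fin p) ℝ) :
    frobInner A (B + C) = frobInner A B + frobInner A C := by
  simp [frobInner, Matrix.mul_add]

lemma frobInner_smul_right (c : ℝ) (A B : Matrix (Fin p) (Fin p) ℝ) :
    frobInner A (c • B) = c * frobInner A B := by
  simp [frobInner]

lemma frobInner_sub_right (A B C : Matrix (Fin p) (Fin p) ℝ) :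
    frobInner A (B - C) = frobInner A B - frobInner A C := by
  simp [frobInner, Matrix.mul_sub]

lemma frobInner_add_left (A B C : Matrix (Fin p) (Fin p) ℝ) :
    frobInner (A + B) C = frobInner A C + frobInner B C := by
  simp [frobInner, Matrix.add_mul]

lemma frobInner_smul_left (c : ℝ) (A B : Matrix (Fin p) (Fin p) ℝ) :
    frobInner (c • A) B = c * frobInner A B := by
  simp [frobInner]

lemma frobInner_sub_left (A B C : Matrix (Fin p) (Fin p) ℝ) :
    frobInner (A - B) C = frobInner A C - frobInner B C := by
  simp [frobInner, Matrix.sub_mul]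

lemma elasticNet_add_smul_sub_le {lam α : ℝ} (hlam : 0 ≤ lam) (hα : α ∈ Set.Icc (0 : ℝ) 1)
    (v u : Matrix (Fin p) (Fin p) ℝ) {t : ℝ} (ht : t ∈ Set.Icc (0 : ℝ) 1) :
    elasticNet lam α (v + t • (u - v))
      ≤ elasticNet lam α v + t * (elasticNet lam α u - elasticNet lam α v) := by
  simp only [elasticNet, ← Finset.sum_sub_distrib, Finset.mul_sum, ← Finset.sum_add_distrib]
  refine Finset.sum_le_sum fun i _ => Finset.sum_le_sum fun j _ => ?_
  simp only [Matrix.add_apply, Matrix.smul_apply, Matrix.sub_apply, smul_eq_mul]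
  set x := v i j
  set y := u i j
  have h1 : |x + t * (y - x)| ≤ (1 - t) * |x| + t * |y| := by
    calc |x + t * (y - x)| = |(1 - t) * x + t * y| := by congr 1; ring
      _ ≤ _ := by
        refine (abs_add_le _ _).trans_eq ?_
        rw [abs_mul, abs_mul, abs_of_nonneg (sub_nonneg.2 ht.2), abs_of_nonneg ht.1]
  have h2 : (x + t * (y - x)) ^ 2 ≤ (1 - t) * x ^ 2 + t * y ^ 2 := by
    nlinarith [mul_nonneg (mul_nonneg ht.1 (sub_nonneg.2 ht.2)) (sq_nonneg (y - x))]
  have h1' := mul_le_mul_of_nonneg_left h1 (mul_nonneg hα.1 hlam)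
  have h2' := mul_le_mul_of_nonneg_left h2
    (mul_nonneg (div_nonneg (sub_nonneg.2 hα.2) zero_le_two) hlam)
  linarith

/-- First-order condition for a smooth plus convex function on a segment: the smooth part is
differentiated, while the convex part is replaced by its chord, of slope `c`, so it need not be
differentiable. -/
lemma nonneg_deriv_add_of_eventually_le {h : ℝ → ℝ} {h' c : ℝ} (hd : HasDerivAt h h' 0)
    (hmin : ∀ᶠ t in nhdsWithin (0 : ℝ) (Set.Ioi 0), h 0 ≤ h t + t * c) : 0 ≤ h' + c := by
  have hs := hd.tendsto_slope_zero_right.add_const c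
  refine ge_of_tendsto hs ?_
  filter_upwards [hmin, self_mem_nhdsWithin] with t ht ht0
  have ht0 : 0 < t := ht0
  have : 0 ≤ t⁻¹ * (h t + t * c - h 0) := by
    apply mul_nonneg (inv_nonneg.2 ht0.le); linarith
  calc 0 ≤ t⁻¹ * (h t + t * c - h 0) := this
    _ = _ := by simp only [zero_add, smul_eq_mul]; field_simp; ring

lemma hasDerivAt_frobNorm_sq_add_smul (A B : Matrix (Fin p) (Fin p) ℝ) :
    HasDerivAt (fun t : ℝ => frobNorm (A + t • B) ^ 2) (2 * frobInner A B) 0 := by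
  have e : (fun t : ℝ => frobNorm (A + t • B) ^ 2) = fun t =>
      frobInner A A + (2 * frobInner A B * t + frobInner B B * t ^ 2) := by
    ext t
    rw [frobNorm_sq, frobInner_add_left, frobInner_add_right, frobInner_add_right,
      frobInner_smul_left, frobInner_smul_left, frobInner_smul_right, frobInner_smul_right,
      frobInner_comm B A]
    ring
  rw [e]
  have := (((hasDerivAt_id (0 : ℝ)).const_mul (2 * frobInner A B)).add
    ((hasDerivAt_pow 2 (0 : ℝ)).const_mul (frobInner B B))).const_add (frobInner A A)
  convert! this using 1
  simp

lemma IsProx.variational {lam α γ : ℝ} (hlam : 0 ≤ lam) (hα : α ∈ Set.Icc (0 : ℝ) 1)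
    {w v u : Matrix (Fin p) (Fin p) ℝ} (hv : IsProx lam α γ w v) (hu : u.IsSymm) :
    0 ≤ 1 / γ * frobInner (v - w) (u - v) + (elasticNet lam α u - elasticNet lam α v) := by
  have hd := (hasDerivAt_frobNorm_sq_add_smul (v - w) (u - v)).const_mul (1 / (2 * γ))
  have h := nonneg_deriv_add_of_eventually_le hd (c := elasticNet lam α u - elasticNet lam α v) ?_
  · convert h using 2
    -- With `1 / 0 = 0`, both sides vanish in this case.
    by_cases hγ : γ = 0
    · simp [hγ]
    · field_simp
  · filter_upwards [Ioo_mem_nhdsGT (zero_lt_one' ℝ)] with t ht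
    have hs : (v + t • (u - v)).IsSymm := hv.1.add ((hu.sub hv.1).smul t)
    have hm : elasticNet lam α v + 1 / (2 * γ) * frobNorm (v - w) ^ 2
        ≤ elasticNet lam α (v + t • (u - v))
          + 1 / (2 * γ) * frobNorm (v + t • (u - v) - w) ^ 2 := hv.2 hs
    have hc := elasticNet_add_smul_sub_le hlam hα v u ⟨ht.1.le, ht.2.le⟩
    have e : v + t • (u - v) - w = v - w + t • (u - v) := by abel
    rw [e] at hm
    simp only [zero_smul, add_zero]
    linarith

lemma hasDerivAt_det_one_add_smul (M : Matrix (Fin p) (Fin p) ℝ) :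
    HasDerivAt (fun t : ℝ => (1 + t • M).det) M.trace 0 := by
  have e := fun t : ℝ => Matrix.det_one_add_smul t M
  simp_rw [e]
  -- `det (1 + t M) = 1 + t Tr M + t² q(t)`: only the linear term survives in the derivative at `0`.
  set q := (Matrix.det (1 + (Polynomial.X : Polynomial ℝ) • M.map Polynomial.C)).divX.divX
  have := (((hasDerivAt_id (0 : ℝ)).const_mul M.trace).const_add 1).add
    ((q.hasDerivAt 0).mul (hasDerivAt_pow 2 (0 : ℝ)))
  convert! this using 1
  simp

/-- Factoring `det (A + t D) = det A · det (1 + t A⁻¹ D)` reduces the log-determinant to the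
derivative of `det` at the identity. -/
lemma hasDerivAt_smooth_objective {A : Matrix (Fin p) (Fin p) ℝ} (hA : A.PosDef)
    (S D : Matrix (Fin p) (Fin p) ℝ) :
    HasDerivAt (fun t : ℝ => -Real.log (A + t • D).det + ((A + t • D) * S).trace)
      (((S - A⁻¹) * D).trace) 0 := by
  have hdet := hA.det_pos
  have e : ∀ t : ℝ, (A + t • D).det = A.det * (1 + t • (A⁻¹ * D)).det := fun t => by
    rw [← Matrix.det_mul, Matrix.mul_add, Matrix.mul_one, Matrix.mul_smul, ← Matrix.mul_assoc,
      Matrix.mul_nonsing_inv _ hdet.ne'.isUnit, Matrix.one_mul]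
  have h1 : HasDerivAt (fun t : ℝ => (A + t • D).det) (A.det * (A⁻¹ * D).trace) 0 := by
    simp_rw [e]
    exact (hasDerivAt_det_one_add_smul _).const_mul _
  have h2 := (h1.log (by simpa using hdet.ne')).neg
  have h3 : HasDerivAt (fun t : ℝ => ((A + t • D) * S).trace) (D * S).trace 0 := by
    have e3 : (fun t : ℝ => ((A + t • D) * S).trace) = fun t => (A * S).trace + (D * S).trace * t := by
      ext t
      simp [Matrix.add_mul, mul_comm]
    rw [e3]
    simpa using ((hasDerivAt_id (0 : ℝ)).const_mul (D * S).trace).const_add (A * S).trace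
  convert! h2.add h3 using 1
  rw [Matrix.sub_mul, Matrix.trace_sub, Matrix.trace_mul_comm D S]
  simp only [zero_smul, add_zero]
  field_simp
  ring

lemma IsSolution.variational {S : Matrix (Fin p) (Fin p) ℝ} {lam α l : ℝ} {ψ : ℝ≥0∞} (hlam : 0 ≤ lam)
    (hα : α ∈ Set.Icc (0 : ℝ) 1) (hS : S.IsSymm) {A u : Matrix (Fin p) (Fin p) ℝ}
    (hA : IsSolution S lam α A) (hl : 0 < l) (hA' : A ∈ boundedPD l ψ) (hu : u.IsSymm) :
    0 ≤ frobInner (S - A⁻¹) (u - A) + (elasticNet lam α u - elasticNet lam α A) := by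
  have hAs : A.IsSymm := by
    have := hA.1.1.eq
    rwa [Matrix.conjTranspose_eq_transpose_of_trivial] at this
  have hAi : A⁻¹.IsSymm := by
    have := hA.1.inv.1.eq
    rwa [Matrix.conjTranspose_eq_transpose_of_trivial] at this
  have hD : (u - A).IsSymm := hu.sub hAs
  have hDh : (u - A).IsHermitian := by
    rw [Matrix.IsHermitian, Matrix.conjTranspose_eq_transpose_of_trivial]; exact hD
  have h := nonneg_deriv_add_of_eventually_le (hasDerivAt_smooth_objective hA.1 S (u - A))
    (c := elasticNet lam α u - elasticNet lam α A) ?_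
  · rwa [frobInner, (hS.sub hAi).eq]
  · filter_upwards [Ioo_mem_nhdsGT (zero_lt_one' ℝ), eventually_posDef_add_smul hl hA' hDh]
      with t ht hpd
    have hm : objective S lam α A ≤ objective S lam α (A + t • (u - A)) := hA.2 hpd
    have hc := elasticNet_add_smul_sub_le hlam hα A u ⟨ht.1.le, ht.2.le⟩
    simp only [objective] at hm
    simp only [zero_smul, add_zero]
    linarith

/-- Nonexpansiveness of the proximal map, the solution being a fixed point of the proximal gradient
step. -/
lemma IsProx.frobNorm_sq_sub_solution_le {S : Matrix (Fin p) (Fin p) ℝ} {lam α γ l : ℝ} {ψ : ℝ≥0∞}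
    (hlam : 0 ≤ lam) (hα : α ∈ Set.Icc (0 : ℝ) 1) (hγ : 0 < γ) (hS : S.IsSymm)
    {A w v : Matrix (Fin p) (Fin p) ℝ} (hv : IsProx lam α γ w v) (hA : IsSolution S lam α A)
    (hl : 0 < l) (hA' : A ∈ boundedPD l ψ) :
    frobNorm (v - A) ^ 2 ≤ frobNorm (w - (A - γ • (S - A⁻¹))) ^ 2 := by
  have hAs : A.IsSymm := by
    have := hA.1.1.eq
    rwa [Matrix.conjTranspose_eq_transpose_of_trivial] at this
  have h1 := hv.variational hlam hα hAs
  have h2 := hA.variational hlam hα hS hl hA' hv.1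
  -- Testing each variational inequality at the other point and adding cancels the penalties.
  have h3 : 0 ≤ frobInner (v - w) (A - v) + γ * frobInner (S - A⁻¹) (v - A) := by
    have h := mul_nonneg hγ.le (add_nonneg h1 h2)
    have e : γ * (1 / γ * frobInner (v - w) (A - v)) = frobInner (v - w) (A - v) := by field_simp
    linarith
  have hn := frobInner_self_nonneg ((v - A) - (w - (A - γ • (S - A⁻¹))))
  rw [frobNorm_sq, frobNorm_sq]
  set G := S - A⁻¹
  set b := w - (A - γ • G) with hb
  -- Thus `h3` says `‖v - A‖² ≤ ⟨v - A, b⟩`, and `hn`, which is `‖(v - A) - b‖² ≥ 0`, turns this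
  -- into `‖v - A‖² ≤ ‖b‖²`.
  have e1 : frobInner (v - w) (A - v) + γ * frobInner G (v - A)
      = frobInner (v - A) b - frobInner (v - A) (v - A) := by
    have hvw : v - w = (v - A) - b + γ • G := by rw [hb]; abel
    have hAv : A - v = (-1 : ℝ) • (v - A) := by simp
    rw [hvw, hAv, frobInner_smul_right, frobInner_add_left, frobInner_sub_left, frobInner_smul_left,
      frobInner_comm b]
    ring
  rw [e1] at h3
  rw [frobInner_sub_left, frobInner_sub_right (v - A) (v - A), frobInner_sub_right b,
    frobInner_comm b (v - A)] at hn
  linarith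

end StochGlasso

/-! ### Measurability of the exit event and conditional law of a batch -/

namespace StochGlasso

variable {p : ℕ}

lemma isClosed_setOf_posSemidef : IsClosed {A : Matrix (Fin p) (Fin p) ℝ | A.PosSemidef} := by
  have e : {A : Matrix (Fin p) (Fin p) ℝ | A.PosSemidef} =
      {A | A.conjTranspose = A} ∩ ⋂ x : Fin p → ℝ, {A | 0 ≤ star x ⬝ᵥ (A.mulVec x)} := by
    ext A
    simp only [Set.mem_ofPred_eq, Matrix.posSemidef_iff_dotProduct_mulVec, Set.mem_inter_iff,
      Set.mem_iInter, Matrix.IsHermitian]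
  rw [e]
  refine (isClosed_eq (by fun_prop) (by fun_prop)).inter (isClosed_iInter fun x => ?_)
  exact isClosed_le (by fun_prop) (by fun_prop)

lemma nonneg_of_mem_spectrum {A : Matrix (Fin p) (Fin p) ℝ} (hA : A.PosSemidef) {t : ℝ}
    (ht : t ∈ spectrum ℝ A) : 0 ≤ t := by
  rw [hA.1.spectrum_real_eq_range_eigenvalues] at ht
  obtain ⟨i, rfl⟩ := ht
  exact hA.eigenvalues_nonneg i

/-- Restates the eigenvalue bounds as semidefinite inequalities, which are closed conditions; `0 <
l` makes positive definiteness automatic. -/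
lemma mem_boundedPD_iff {l : ℝ} {ψ : ℝ≥0∞} (hl : 0 < l) (A : Matrix (Fin p) (Fin p) ℝ) :
    A ∈ boundedPD l ψ ↔
      (A + (-l) • 1).PosSemidef ∧ (ψ = ⊤ ∨ (-A + ψ.toReal • 1).PosSemidef) := by
  constructor
  · intro h
    obtain ⟨U, d, -, h2, hA, hd⟩ := exists_diagonalization_of_mem_boundedPD h
    refine ⟨posSemidef_add_smul_one_of_diagonalization h2 hA fun i => by linarith [(hd i).1], ?_⟩
    by_cases hψ : ψ = ⊤
    · exact Or.inl hψ
    · have hA' : -A = U * Matrix.diagonal (fun i => -d i) * U.transpose := by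
        rw [← Matrix.diagonal_neg, Matrix.mul_neg, Matrix.neg_mul, ← hA]
      refine Or.inr (posSemidef_add_smul_one_of_diagonalization h2 hA' fun i => ?_)
      have := (ENNReal.ofReal_le_iff_le_toReal hψ).1 (hd i).2
      linarith
  · rintro ⟨h1, h2⟩
    have hpd : A.PosDef := by
      have := (Matrix.PosDef.one.smul hl).posSemidef_add h1
      simpa using this
    refine ⟨hpd, fun t ht => ⟨?_, ?_⟩⟩
    · have : t + (-l) ∈ spectrum ℝ (A + (-l) • 1) := by
        rw [← Algebra.algebraMap_eq_smul_one, add_comm A]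
        exact spectrum.add_mem_add_iff.2 ht
      linarith [nonneg_of_mem_spectrum h1 this]
    · rcases h2 with rfl | h2
      · exact le_top
      by_cases hψ : ψ = ⊤
      · simp [hψ]
      rw [ENNReal.ofReal_le_iff_le_toReal hψ]
      have : -t + ψ.toReal ∈ spectrum ℝ (-A + ψ.toReal • 1) := by
        rw [← Algebra.algebraMap_eq_smul_one, add_comm (-A)]
        refine spectrum.add_mem_add_iff.2 ?_
        rw [← spectrum.neg_eq]
        simpa using ht
      linarith [nonneg_of_mem_spectrum h2 this]

lemma isClosed_boundedPD {l : ℝ} (ψ : ℝ≥0∞) (hl : 0 < l) :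
    IsClosed (boundedPD l ψ : Set (Matrix (Fin p) (Fin p) ℝ)) := by
  have e : (boundedPD l ψ : Set (Matrix (Fin p) (Fin p) ℝ)) =
      (fun A => A + (-l) • 1) ⁻¹' {A | A.PosSemidef} ∩
        ({_A | ψ = ⊤} ∪ (fun A => -A + ψ.toReal • 1) ⁻¹' {A | A.PosSemidef}) := by
    ext A
    exact mem_boundedPD_iff hl A
  rw [e]
  exact (isClosed_setOf_posSemidef.preimage (by fun_prop)).inter
    (isClosed_const.union (isClosed_setOf_posSemidef.preimage (by fun_prop)))

lemma coe_lt_exitTime_iff {Ω : Type*} (θ : ℕ → Ω → Matrix (Fin p) (Fin p) ℝ) (l : ℝ) (ψ : ℝ≥0∞)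
    (k : ℕ) (ω : Ω) :
    (k : WithTop ℕ) < exitTime θ l ψ ω ↔ ∀ j ≤ k, θ j ω ∈ boundedPD l ψ := by
  have h := hittingAfter_le_iff (u := θ) (s := (boundedPD l ψ)ᶜ) (n := 0) (i := k) (ω := ω)
  refine not_le.symm.trans ((not_congr h).trans ?_)
  simp

/-- The first `k + 1` iterates, as a random element. -/
def path {Ω : Type*} (θ : ℕ → Ω → Matrix (Fin p) (Fin p) ℝ) (k : ℕ) (ω : Ω) :
    Fin (k + 1) → Fin p → Fin p → ℝ :=
  fun m i j => θ m ω i j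

lemma comap_path {Ω : Type*} (θ : ℕ → Ω → Matrix (Fin p) (Fin p) ℝ) (k : ℕ) :
    MeasurableSpace.comap (path θ k) inferInstance = history θ k := by
  simp only [history, MeasurableSpace.pi, MeasurableSpace.comap_iSup, MeasurableSpace.comap_comp]
  rfl

/-- The paths which have stayed in `boundedPD l ψ`. -/
def boundedPaths (k : ℕ) (l : ℝ) (ψ : ℝ≥0∞) : Set (Fin (k + 1) → Fin p → Fin p → ℝ) :=
  {x | ∀ m, (x m : Matrix (Fin p) (Fin p) ℝ) ∈ boundedPD l ψ}

lemma measurableSet_boundedPaths (k : ℕ) {l : ℝ} (ψ : ℝ≥0∞) (hl : 0 < l) :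
    MeasurableSet (boundedPaths k l ψ : Set (Fin (k + 1) → Fin p → Fin p → ℝ)) := by
  have hc : MeasurableSet (α := Fin p → Fin p → ℝ) (boundedPD l ψ) :=
    IsClosed.measurableSet (α := Fin p → Fin p → ℝ) (isClosed_boundedPD ψ hl)
  have e : (boundedPaths k l ψ : Set (Fin (k + 1) → Fin p → Fin p → ℝ)) =
      ⋂ m, Set.preimage (β := Fin p → Fin p → ℝ) (fun x => x m) (boundedPD l ψ) := by
    ext x
    rw [Set.mem_iInter]
    rfl
  rw [e]
  exact MeasurableSet.iInter fun m => hc.preimage (measurable_pi_apply m)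

lemma path_mem_boundedPaths_iff {Ω : Type*} (θ : ℕ → Ω → Matrix (Fin p) (Fin p) ℝ) (k : ℕ) (l : ℝ)
    (ψ : ℝ≥0∞) (ω : Ω) :
    path θ k ω ∈ boundedPaths k l ψ ↔ (k : WithTop ℕ) < exitTime θ l ψ ω := by
  rw [coe_lt_exitTime_iff]
  exact ⟨fun h j hj => h ⟨j, by omega⟩, fun h m => h m (by omega)⟩

/-- A measurable space which is countably generated has a countable family of measurable sets which
determines probability measures. -/
lemma exists_countable_forall_measureReal_eq_imp_eq (β : Type*) [MeasurableSpace β]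
    [MeasurableSpace.CountablyGenerated β] :
    ∃ C : Set (Set β), C.Countable ∧ (∀ B ∈ C, MeasurableSet B) ∧
      ∀ μ ν : Measure β, IsProbabilityMeasure μ → IsProbabilityMeasure ν →
        (∀ B ∈ C, μ.real B = ν.real B) → μ = ν := by
  set 𝒜 := MeasurableSpace.countableGeneratingSet β
  have hgen : ‹MeasurableSpace β› = MeasurableSpace.generateFrom (generateSetAlgebra 𝒜) := by
    rw [generateFrom_generateSetAlgebra_eq, MeasurableSpace.generateFrom_countableGeneratingSet]
  refine ⟨generateSetAlgebra 𝒜,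
    countable_generateSetAlgebra MeasurableSpace.countable_countableGeneratingSet, fun B hB => ?_,
    fun μ ν hμ hν h => ?_⟩
  · rw [hgen]
    exact MeasurableSpace.measurableSet_generateFrom hB
  · refine ext_of_generate_finite _ hgen
      (isSetAlgebra_generateSetAlgebra (𝒜 := 𝒜)).isSetRing.isSetSemiring.isPiSystem
      (fun B hB => ?_) (by simp)
    have := h B hB
    rwa [measureReal_def, measureReal_def,
      ENNReal.toReal_eq_toReal_iff' (measure_ne_top _ _) (measure_ne_top _ _)] at this

section Sampling

variable {Ω : Type*} [MeasurableSpace Ω] {P : Measure Ω}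
  {S : Matrix (Fin p) (Fin p) ℝ} {lam α γ : ℝ} {N : ℕ → ℕ} {θ₀ : Matrix (Fin p) (Fin p) ℝ}
  {z : (k : ℕ) → Fin (N k) → Ω → EuclideanSpace ℝ (Fin p)} {θ : ℕ → Ω → Matrix (Fin p) (Fin p) ℝ}

lemma IsStochProxProcess.measurable_path (hθ : IsStochProxProcess P S lam α γ N θ₀ z θ) (k : ℕ) :
    Measurable (path θ k) :=
  measurable_pi_lambda _ fun m => measurable_pi_lambda _ fun i => measurable_pi_lambda _ fun j =>
    hθ.measurable_theta m i j

variable [IsProbabilityMeasure P]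

/-- The null set in `draw` depends on `B`; a countable determining family gives one null set for the
equality of measures. -/
lemma IsStochProxProcess.ae_condDistrib_eq (hθ : IsStochProxProcess P S lam α γ N θ₀ z θ) (k : ℕ) :
    ∀ᵐ ω ∂P, (∀ j ≤ k, (θ j ω).PosDef) →
      condDistrib (fun ω i => z (k + 1) i ω) (path θ k) P (path θ k ω)
        = gaussianSample (N (k + 1)) (θ k ω)⁻¹ := by
  obtain ⟨C, hC, hCm, hext⟩ := exists_countable_forall_measureReal_eq_imp_eq
    (Fin (N (k + 1)) → EuclideanSpace ℝ (Fin p))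
  have hz : Measurable fun ω (i : Fin (N (k + 1))) => z (k + 1) i ω :=
    measurable_pi_lambda _ fun i => hθ.measurable_z _ i
  have h : ∀ᵐ ω ∂P, ∀ B ∈ C, (∀ j ≤ k, (θ j ω).PosDef) →
      (condDistrib (fun ω i => z (k + 1) i ω) (path θ k) P (path θ k ω)).real B
        = (gaussianSample (N (k + 1)) (θ k ω)⁻¹).real B := by
    rw [ae_ball_iff hC]
    intro B hB
    have h1 := condDistrib_ae_eq_condExp (μ := P) (hθ.measurable_path k) hz (hCm B hB)
    rw [comap_path] at h1
    filter_upwards [h1, hθ.draw k B (hCm B hB)] with ω h1 h2 hpd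
    rw [h1, ← h2 hpd]
    rfl
  filter_upwards [h] with ω h hpd
  exact hext _ _ inferInstance inferInstance fun B hB => h B hB hpd

/-- The event `{τ > k}` is a function of the path, so the joint law of path and batch disintegrates
over it, and there the conditional law is the Gaussian one. Integrals in `ℝ≥0∞` require no prior
integrability. -/
lemma IsStochProxProcess.lintegral_indicator_exitTime
    (hθ : IsStochProxProcess P S lam α γ N θ₀ z θ) {l : ℝ} (ψ : ℝ≥0∞) (hl : 0 < l) (k : ℕ)
    {F : (Fin p → Fin p → ℝ) × (Fin (N (k + 1)) → EuclideanSpace ℝ (Fin p)) → ℝ≥0∞}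
    (hF : Measurable F) :
    ∫⁻ ω, {ω | (k : WithTop ℕ) < exitTime θ l ψ ω}.indicator
        (fun ω => F (θ k ω, fun i => z (k + 1) i ω)) ω ∂P
      = ∫⁻ ω, {ω | (k : WithTop ℕ) < exitTime θ l ψ ω}.indicator
        (fun ω => ∫⁻ x, F (θ k ω, x) ∂gaussianSample (N (k + 1)) (θ k ω)⁻¹) ω ∂P := by
  have hz : Measurable fun ω (i : Fin (N (k + 1))) => z (k + 1) i ω :=
    measurable_pi_lambda _ fun i => hθ.measurable_z _ i
  have hX := hθ.measurable_path k
  set G : (Fin (k + 1) → Fin p → Fin p → ℝ) × (Fin (N (k + 1)) → EuclideanSpace ℝ (Fin p)) → ℝ≥0∞ :=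
    (Prod.fst ⁻¹' boundedPaths k l ψ).indicator fun y => F (y.1 (Fin.last k), y.2) with hG
  have hGm : Measurable G :=
    (hF.comp (((measurable_pi_apply _).comp measurable_fst).prodMk measurable_snd)).indicator
      ((measurableSet_boundedPaths k ψ hl).preimage measurable_fst)
  have hl1 : ∀ ω x, G (path θ k ω, x) = {ω | (k : WithTop ℕ) < exitTime θ l ψ ω}.indicator
      (fun ω => F (θ k ω, x)) ω := by
    intro ω x
    by_cases h : (k : WithTop ℕ) < exitTime θ l ψ ω
    · rw [Set.indicator_of_mem (by exact h), hG, Set.indicator_of_mem]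
      · rfl
      exact (path_mem_boundedPaths_iff θ k l ψ ω).2 h
    · rw [Set.indicator_of_notMem (by exact h), hG, Set.indicator_of_notMem]
      exact fun h' => h ((path_mem_boundedPaths_iff θ k l ψ ω).1 h')
  calc _ = ∫⁻ ω, G (path θ k ω, fun i => z (k + 1) i ω) ∂P := by
        refine lintegral_congr fun ω => ?_
        rw [hl1]
        rfl
    _ = ∫⁻ y, G y ∂P.map fun ω => (path θ k ω, fun i => z (k + 1) i ω) :=
        (lintegral_map hGm (hX.prodMk hz)).symm
    _ = ∫⁻ ω, ∫⁻ x, G (path θ k ω, x)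
          ∂condDistrib (fun ω i => z (k + 1) i ω) (path θ k) P (path θ k ω) ∂P := by
        rw [← compProd_map_condDistrib hz.aemeasurable, Measure.lintegral_compProd hGm,
          lintegral_map hGm.lintegral_kernel_prod_right' hX]
    _ = _ := by
        refine lintegral_congr_ae ?_
        filter_upwards [hθ.ae_condDistrib_eq k] with ω hω
        simp_rw [hl1]
        by_cases h : (k : WithTop ℕ) < exitTime θ l ψ ω
        · rw [Set.indicator_of_mem (by exact h),
            hω fun j hj => ((coe_lt_exitTime_iff θ l ψ k ω).1 h j hj).1]
          refine lintegral_congr fun x => ?_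
          rw [Set.indicator_of_mem (by exact h)]
        · rw [Set.indicator_of_notMem (by exact h)]
          simp [Set.indicator_of_notMem (show ω ∉ {ω | (k : WithTop ℕ) < exitTime θ l ψ ω} from h)]

end Sampling

end StochGlasso

/-! ### The recursion for the stopped mean square error -/

namespace StochGlasso

variable {p : ℕ}

lemma measurable_frobNorm_sq_add_sampleCov (N : ℕ) (γ : ℝ) (B C : Matrix (Fin p) (Fin p) ℝ) :
    Measurable fun y : (Fin p → Fin p → ℝ) × (Fin N → EuclideanSpace ℝ (Fin p)) =>
      frobNorm ((Matrix.of y.1 - B) + γ • (sampleCov y.2 - C)) ^ 2 := by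
  simp only [frobNorm_sq_eq_sum, Matrix.add_apply, Matrix.smul_apply, Matrix.sub_apply,
    Matrix.of_apply, sampleCov_apply, smul_eq_mul]
  refine Finset.measurable_sum _ fun i _ => Finset.measurable_sum _ fun j _ => ?_
  have h1 : Measurable fun y : (Fin p → Fin p → ℝ) × (Fin N → EuclideanSpace ℝ (Fin p)) =>
      y.1 i j := by fun_prop
  have h2 : Measurable fun y : (Fin p → Fin p → ℝ) × (Fin N → EuclideanSpace ℝ (Fin p)) =>
      ∑ n, y.2 n i * y.2 n j := Finset.measurable_sum _ fun n _ => by fun_prop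
  exact ((h1.sub_const _).add (((h2.const_mul _).sub_const _).const_mul _)).pow_const 2

/-- Writing `sampleCov x - B⁻¹` as `(A⁻¹ - B⁻¹) + (sampleCov x - A⁻¹)` separates the contracting
drift from the centred noise. -/
lemma lintegral_gaussianSample_le {γ l : ℝ} {ψ : ℝ≥0∞} (hγ : 0 ≤ γ) (hl : 0 < l)
    (hγl : γ ≤ l ^ 2) {A B : Matrix (Fin p) (Fin p) ℝ} (hA : A ∈ boundedPD l ψ)
    (hB : B ∈ boundedPD l ψ) {N : ℕ} (hN : 0 < N) :
    ∫⁻ x, ENNReal.ofReal (frobNorm ((A - B) + γ • (sampleCov x - B⁻¹)) ^ 2) ∂gaussianSample N A⁻¹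
      ≤ ENNReal.ofReal (rate γ ψ * frobNorm (A - B) ^ 2
        + 2 * γ ^ 2 * (l ^ 2)⁻¹ * ((p : ℝ) + (p : ℝ) ^ 2) * (N : ℝ)⁻¹) := by
  have h := integral_sq_frobNorm_add_sampleCov_le hA.1.inv.posSemidef hN
    ((A - B) + γ • (A⁻¹ - B⁻¹)) γ
  have e : ∀ x : Fin N → EuclideanSpace ℝ (Fin p), (A - B) + γ • (A⁻¹ - B⁻¹)
      + γ • (sampleCov x - A⁻¹) = (A - B) + γ • (sampleCov x - B⁻¹) := fun x => by
    simp only [smul_sub]; abel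
  simp_rw [e] at h
  rw [← ofReal_integral_eq_lintegral_ofReal h.1 (Filter.Eventually.of_forall fun x => sq_nonneg _)]
  refine ENNReal.ofReal_le_ofReal (h.2.trans ?_)
  have h1 := frobNorm_sq_gradient_step_le hγ hl hγl hA hB
  have h2 := mul_le_mul_of_nonneg_left (trace_sq_add_frobNorm_sq_inv_le hl hA)
    (by positivity : (0 : ℝ) ≤ γ ^ 2 * (N : ℝ)⁻¹)
  linarith

variable {Ω : Type*} [MeasurableSpace Ω] {P : Measure Ω}
  {S : Matrix (Fin p) (Fin p) ℝ} {lam α γ : ℝ} {N : ℕ → ℕ} {θ₀ θhat : Matrix (Fin p) (Fin p) ℝ}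
  {z : (k : ℕ) → Fin (N k) → Ω → EuclideanSpace ℝ (Fin p)} {θ : ℕ → Ω → Matrix (Fin p) (Fin p) ℝ}

lemma IsStochProxProcess.measurableSet_lt_exitTime (hθ : IsStochProxProcess P S lam α γ N θ₀ z θ)
    {l : ℝ} (ψ : ℝ≥0∞) (hl : 0 < l) (k : ℕ) :
    MeasurableSet {ω | (k : WithTop ℕ) < exitTime θ l ψ ω} := by
  convert (measurableSet_boundedPaths k ψ hl).preimage (hθ.measurable_path k) using 1
  ext ω
  exact (path_mem_boundedPaths_iff θ k l ψ ω).symm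

lemma IsStochProxProcess.measurable_frobNorm_sq_sub
    (hθ : IsStochProxProcess P S lam α γ N θ₀ z θ) (B : Matrix (Fin p) (Fin p) ℝ) (k : ℕ) :
    Measurable fun ω => frobNorm (θ k ω - B) ^ 2 := by
  simp only [frobNorm_sq_eq_sum, Matrix.sub_apply]
  exact Finset.measurable_sum _ fun i _ => Finset.measurable_sum _ fun j _ =>
    ((hθ.measurable_theta k i j).sub_const _).pow_const 2

variable [IsProbabilityMeasure P]

/-- One step of the process. -/
lemma IsStochProxProcess.lintegral_succ_le (hθ : IsStochProxProcess P S lam α γ N θ₀ z θ)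
    (hS : S.IsSymm) (hlam : 0 ≤ lam) (hα : α ∈ Set.Icc (0 : ℝ) 1) (hγ : 0 < γ)
    (hsol : IsSolution S lam α θhat) {l : ℝ} {ψ : ℝ≥0∞} (hl : 0 < l)
    (hlψ : ENNReal.ofReal l ≤ ψ) (hθhat : θhat ∈ boundedPD l ψ) (hγl : γ ≤ l ^ 2) (k : ℕ)
    (hN : 0 < N (k + 1)) :
    ∫⁻ ω, {ω | ((k + 1 : ℕ) : WithTop ℕ) < exitTime θ l ψ ω}.indicator
        (fun ω => ENNReal.ofReal (frobNorm (θ (k + 1) ω - θhat) ^ 2)) ω ∂P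
      ≤ ENNReal.ofReal (rate γ ψ) * ∫⁻ ω, {ω | (k : WithTop ℕ) < exitTime θ l ψ ω}.indicator
          (fun ω => ENNReal.ofReal (frobNorm (θ k ω - θhat) ^ 2)) ω ∂P
        + ENNReal.ofReal (2 * γ ^ 2 * (l ^ 2)⁻¹ * ((p : ℝ) + (p : ℝ) ^ 2) * (N (k + 1) : ℝ)⁻¹) := by
  have hr := rate_nonneg hγ.le hl hlψ hγl
  set c := 2 * γ ^ 2 * (l ^ 2)⁻¹ * ((p : ℝ) + (p : ℝ) ^ 2) * (N (k + 1) : ℝ)⁻¹ with hc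
  have hc0 : 0 ≤ c := by positivity
  have hF := (measurable_frobNorm_sq_add_sampleCov (N (k + 1)) γ θhat θhat⁻¹).ennreal_ofReal
  calc _ ≤ ∫⁻ ω, {ω | (k : WithTop ℕ) < exitTime θ l ψ ω}.indicator (fun ω => ENNReal.ofReal
          (frobNorm ((θ k ω - θhat)
            + γ • (sampleCov (fun i => z (k + 1) i ω) - θhat⁻¹)) ^ 2)) ω ∂P := by
        refine lintegral_mono_ae ?_
        filter_upwards [hθ.step k] with ω hω
        -- Enlarging `{τ > k + 1}` to `{τ > k}` leaves an event determined by the past of the draw.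
        refine Set.indicator_apply_le fun h => ?_
        have hb := (coe_lt_exitTime_iff θ l ψ (k + 1) ω).1 h
        have hk : ω ∈ {ω | (k : WithTop ℕ) < exitTime θ l ψ ω} :=
          (coe_lt_exitTime_iff θ l ψ k ω).2 fun j hj => hb j (by omega)
        rw [Set.indicator_of_mem hk]
        have hprox := hω fun j hj => (hb j (by omega)).1
        refine ENNReal.ofReal_le_ofReal
          ((hprox.frobNorm_sq_sub_solution_le hlam hα hγ hS hsol hl hθhat).trans_eq ?_)
        -- `S` occurs in both arguments of the prox and cancels.
        congr 2
        simp only [smul_sub]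
        abel
    _ = ∫⁻ ω, {ω | (k : WithTop ℕ) < exitTime θ l ψ ω}.indicator (fun ω => ∫⁻ x, ENNReal.ofReal
          (frobNorm ((θ k ω - θhat) + γ • (sampleCov x - θhat⁻¹)) ^ 2)
            ∂gaussianSample (N (k + 1)) (θ k ω)⁻¹) ω ∂P :=
        hθ.lintegral_indicator_exitTime ψ hl k hF
    _ ≤ ∫⁻ ω, (ENNReal.ofReal (rate γ ψ) * {ω | (k : WithTop ℕ) < exitTime θ l ψ ω}.indicator
          (fun ω => ENNReal.ofReal (frobNorm (θ k ω - θhat) ^ 2)) ω + ENNReal.ofReal c) ∂P := by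
        -- Off the event the left side is `0`, so the noise term `c` may be added everywhere; it
        -- integrates to `c` under a probability measure.
        refine lintegral_mono fun ω => Set.indicator_apply_le' (fun h => ?_) fun _ => bot_le
        rw [Set.indicator_of_mem h, ← ENNReal.ofReal_mul hr,
          ← ENNReal.ofReal_add (mul_nonneg hr (sq_nonneg _)) hc0]
        exact lintegral_gaussianSample_le hγ.le hl hγl
          ((coe_lt_exitTime_iff θ l ψ k ω).1 h k le_rfl) hθhat hN
    _ = _ := by
        rw [lintegral_add_right _ measurable_const, lintegral_const_mul' _ _ ENNReal.ofReal_ne_top]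
        simp

lemma IsStochProxProcess.lintegral_le (hθ : IsStochProxProcess P S lam α γ N θ₀ z θ)
    (hS : S.IsSymm) (hlam : 0 ≤ lam) (hα : α ∈ Set.Icc (0 : ℝ) 1) (hγ : 0 < γ)
    (hN : ∀ k, 1 ≤ k → 0 < N k)
    (hsol : IsSolution S lam α θhat) {l : ℝ} {ψ : ℝ≥0∞} (hl : 0 < l)
    (hlψ : ENNReal.ofReal l ≤ ψ) (hθhat : θhat ∈ boundedPD l ψ) (hγl : γ ≤ l ^ 2) (k : ℕ) :
    ∫⁻ ω, {ω | (k : WithTop ℕ) < exitTime θ l ψ ω}.indicator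
        (fun ω => ENNReal.ofReal (frobNorm (θ k ω - θhat) ^ 2)) ω ∂P
      ≤ ENNReal.ofReal (rate γ ψ ^ k * frobNorm (θ₀ - θhat) ^ 2
          + 2 * γ ^ 2 * (l ^ 2)⁻¹ * ((p : ℝ) + (p : ℝ) ^ 2)
            * ∑ j ∈ Finset.Icc 1 k, (N j : ℝ)⁻¹ * rate γ ψ ^ (k - j)) := by
  have hr := rate_nonneg hγ.le hl hlψ hγl
  have hs : ∀ k, 0 ≤ ∑ j ∈ Finset.Icc 1 k, (N j : ℝ)⁻¹ * rate γ ψ ^ (k - j) := fun k =>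
    Finset.sum_nonneg fun j _ => by positivity
  induction k with
  | zero =>
    calc _ ≤ ∫⁻ _, ENNReal.ofReal (frobNorm (θ₀ - θhat) ^ 2) ∂P := by
          refine lintegral_mono_ae ?_
          filter_upwards [hθ.init] with ω hω
          refine Set.indicator_apply_le' (fun _ => ?_) fun _ => bot_le
          rw [hω]
      _ = _ := by simp
  | succ k ih =>
    refine (hθ.lintegral_succ_le hS hlam hα hγ hsol hl hlψ hθhat hγl k
      (hN _ (by omega))).trans ((add_le_add (mul_le_mul' le_rfl ih) le_rfl).trans_eq ?_)
    have h0 := hs k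
    rw [← ENNReal.ofReal_mul hr, ← ENNReal.ofReal_add (by positivity) (by positivity),
      Finset.sum_Icc_succ_top (by omega)]
    congr 1
    -- Multiplying by the rate ages the earlier noise terms by one step; the new one enters with
    -- exponent `0`.
    have e : ∑ j ∈ Finset.Icc 1 k, (N j : ℝ)⁻¹ * rate γ ψ ^ (k + 1 - j)
        = rate γ ψ * ∑ j ∈ Finset.Icc 1 k, (N j : ℝ)⁻¹ * rate γ ψ ^ (k - j) := by
      rw [Finset.mul_sum]
      refine Finset.sum_congr rfl fun j hj => ?_
      rw [Nat.sub_add_comm (Finset.mem_Icc.1 hj).2, pow_succ]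
      ring
    rw [e, Nat.sub_self, pow_zero]
    ring

end StochGlasso

theorem theorem3 {p : ℕ} {Ω : Type*} [MeasurableSpace Ω] (P : Measure Ω) [IsProbabilityMeasure P]
    (S : Matrix (Fin p) (Fin p) ℝ) (hS : S.PosSemidef)
    (lam α : ℝ) (hlam : 0 < lam) (hα : α ∈ Set.Icc (0 : ℝ) 1)
    (γ : ℝ) (hγ : 0 < γ)
    (N : ℕ → ℕ) (hN : ∀ k, 1 ≤ k → 0 < N k)
    (θ₀ θhat : Matrix (Fin p) (Fin p) ℝ)
    (z : (k : ℕ) → Fin (N k) → Ω → EuclideanSpace ℝ (Fin p))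
    (θ : ℕ → Ω → Matrix (Fin p) (Fin p) ℝ)
    (hθ : StochGlasso.IsStochProxProcess P S lam α γ N θ₀ z θ)
    (hsol : StochGlasso.IsSolution S lam α θhat)
    (l : ℝ) (ψ : ℝ≥0∞) (hl : 0 < l) (hlψ : ENNReal.ofReal l ≤ ψ)
    (hθ₀ : θ₀ ∈ StochGlasso.boundedPD l ψ) (hθhat : θhat ∈ StochGlasso.boundedPD l ψ)
    (hγl : γ ≤ l ^ 2) (k : ℕ) :
    Integrable ({ω | (k : WithTop ℕ) < StochGlasso.exitTime θ l ψ ω}.indicator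
        fun ω => StochGlasso.frobNorm (θ k ω - θhat) ^ 2) P ∧
      ∫ ω, {ω | (k : WithTop ℕ) < StochGlasso.exitTime θ l ψ ω}.indicator
          (fun ω => StochGlasso.frobNorm (θ k ω - θhat) ^ 2) ω ∂P
        ≤ StochGlasso.rate γ ψ ^ k * StochGlasso.frobNorm (θ₀ - θhat) ^ 2
          + 2 * γ ^ 2 * (l ^ 2)⁻¹ * ((p : ℝ) + (p : ℝ) ^ 2)
            * ∑ j ∈ Finset.Icc 1 k, (N j : ℝ)⁻¹ * StochGlasso.rate γ ψ ^ (k - j) := by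
  have hSs : S.IsSymm := by
    have := hS.1.eq
    rwa [Matrix.conjTranspose_eq_transpose_of_trivial] at this
  have hbound := hθ.lintegral_le hSs hlam.le hα hγ hN hsol hl hlψ hθhat hγl k
  have hr := StochGlasso.rate_nonneg hγ.le hl hlψ hγl
  set A := {ω | (k : WithTop ℕ) < StochGlasso.exitTime θ l ψ ω}
  have hmeas : Measurable (A.indicator fun ω => StochGlasso.frobNorm (θ k ω - θhat) ^ 2) :=
    (hθ.measurable_frobNorm_sq_sub θhat k).indicator (hθ.measurableSet_lt_exitTime ψ hl k)
  have hnn : 0 ≤ A.indicator fun ω => StochGlasso.frobNorm (θ k ω - θhat) ^ 2 :=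
    Set.indicator_nonneg fun ω _ => sq_nonneg _
  have e : ∀ ω, ENNReal.ofReal
      (A.indicator (fun ω => StochGlasso.frobNorm (θ k ω - θhat) ^ 2) ω)
      = A.indicator (fun ω => ENNReal.ofReal (StochGlasso.frobNorm (θ k ω - θhat) ^ 2)) ω :=
    fun ω => by by_cases h : ω ∈ A <;> simp [h]
  simp_rw [← e] at hbound
  -- The bound on the lower integral is the `ENNReal.ofReal` of a real number, so it yields both
  -- integrability and the inequality.
  constructor
  · refine ⟨hmeas.aestronglyMeasurable, ?_⟩
    rw [hasFiniteIntegral_iff_ofReal (Filter.Eventually.of_forall hnn)]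
    exact hbound.trans_lt ENNReal.ofReal_lt_top
  · rw [integral_eq_lintegral_of_nonneg_ae (Filter.Eventually.of_forall hnn)
      hmeas.aestronglyMeasurable]
    refine ENNReal.toReal_le_of_le_ofReal ?_ hbound
    have hs : 0 ≤ ∑ j ∈ Finset.Icc 1 k, (N j : ℝ)⁻¹ * StochGlasso.rate γ ψ ^ (k - j) :=
      Finset.sum_nonneg fun j _ => by positivity
    positivity
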